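/- Let $N,M\ge 1$, $d\ge 2$, and consider the square lattice on the torus $\mathbb Z/N\times\mathbb Z/M$: each site $v=(r,c)$ (row, column) is joined by one horizontal bond to $(r,c+1)$ and by one vertical bond to $(r+1,c)$. Each site carries a $d$-level system; $\mathcal H_R=(\mathbb C^d)^{\otimes R}$ is the Hilbert space of a region (set of sites) $R$. For every bond $e$ and each of its two ends let an invertible $d\times d$ matrix $\phi^{e,\mathrm{end}}\in M_d(\mathbb C)$ be given, and let the site tensors be $A^{v}_{x;\alpha}=\prod_{e}\phi^{e,v}_{x,\alpha_e}$ (product over the four bonds $e$ at $v$; $\phi^{e,v}$ is the matrix at the end $v$ of $e$; $x,\alpha_e\in\{1,\dots,d\}$). Let $|\psi\rangle=\sum_x\mathcal C[\{A^v_{x_v}\}_v]\,|x\rangle$ be the resulting (unnormalized) PEPS, $\mathcal C$ being the contraction along all bonds. For a region $R$ let $\Gamma_R$ be the linear map that sends a tensor $X$ on the outgoing bonds of $R$ (the bonds with exactly one end in $R$) to $\sum_{x}\mathcal C[A_{x}X]\,|x\rangle\in\mathcal H_R$, where $A_x$ is the contraction of the tensors in $R$ along the bonds inside $R$. Call $R$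 injective if $\Gamma_R$ is injective, and put $G_R=\operatorname{range}\Gamma_R\subseteq\mathcal H_R$ and $P_R=$ the orthogonal projection of $\mathcal H_R$ onto $G_R^\perp$. Assume that for all regions $R$ and configurations $x$ $$C_R(x)=\prod_{e=(i,j)\subseteq R}\ \sum_{k=1}^d\phi^{e,i}_{x_i,k}\,\phi^{e,j}_{x_j,k}\neq 0 .$$ Then: 1. If $h_e(\cdot,\cdot)$ are real energies and $\beta\in\mathbb R$ with $e^{-\beta h_e(x,y)/2}=\sum_k\phi^{e,i}_{x,k}\phi^{e,j}_{y,k}$ for all bonds $e=(i,j)$ and all $x,y$, then $|\psi\rangle=\sum_x e^{-\frac{\beta}{2}H(x)}|x\rangle$ with $H(x)=\sum_{e=(i,j)}h_e(x_i,x_j)$; so $|\psi\rangle$ is the PEPS of the classical model $H$. 2. The PEPS is not injective: no nonempty region that misses at least one whole row and one whole column of the torus (so that it is a region of the infinite square lattice) is injective; in particular the lattice has no covering by disjoint injective regions of this kind. 3. $|\psi\rangle$ is the unique ground state of its parent Hamiltonians: assign to every site $v$ any region $R_v$ that contains $v$ and its nearest neighbours, and any $h_v\ge 0$ on $\mathcal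 H_{R_v}$ with $\ker h_v=G_{R_v}$. Then $|\psi\rangle$ is, up to scalars, the only ground state of $\sum_v h_v\otimes\mathbb 1$, and $(h_v\otimes\mathbb 1)|\psi\rangle=0$ for every $v$. In particular this holds for $\sum_vP_{R_v}\otimes\mathbb 1$, where all $R_v$ are the $3\times3$ squares centred at $v$, or all $R_v$ are the five-site crosses centred at $v$. 4. Let $N\ge4$, $M\ge5$, let $B$ be any $3\times3$ block, $B'$ its translate by one column to the right, and $B\cup B'$ their union, a block with 3 rows and 4 columns. Inside $\mathcal H_{B\cup B'}$, $$(G_{B}\otimes\mathcal H_{(B\cup B')\setminus B})\cap(\mathcal H_{(B\cup B')\setminus B'}\otimes G_{B'})=G_{B\cup B'} .$$ For $N\ge5$, $M\ge4$ the same holds with $B'$ the translate of $B$ by one row downwards. 5. If $N,M\ge4$ and $R_1$ is the $3\times3$ square and $R_2$ the five-site cross (a site with its four neighbours) with the same centre, then $P_{R_1}=P_{R_2}\otimes\mathbb 1$. -/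

import Mathlib

namespace PEPS

noncomputable section

/-! ### The square lattice on a torus -/

/-- Sites of the `N × M` square lattice on a torus: a site is (row, column). -/
abbrev Site (N M : ℕ) := ZMod N × ZMod M

/-- Bonds (edges). `(v, false)` is the horizontal bond from `v` to its right neighbour,
`(v, true)` is the vertical bond from `v` to its lower neighbour. -/
abbrev Bond (N M : ℕ) := Site N M × Bool

variable {N M : ℕ}

/-- The two end points of a bond: `false` is the left (upper) one, `true` the right (lower) one. -/
def endpoint (e : Bond N M) : Bool → Site N M
  | false => e.1
  | true => if e.2 then (e.1.1 + 1, e.1.2) else (e.1.1, e.1.2 + 1)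

/-- The four bonds at a site. -/
def leftBond (v : Site N M) : Bond N M := ((v.1, v.2 - 1), false)
def rightBond (v : Site N M) : Bond N M := (v, false)
def upBond (v : Site N M) : Bond N M := ((v.1 - 1, v.2), true)
def downBond (v : Site N M) : Bond N M := (v, true)

/-- The rectangular block with `a` rows and `b` columns whose upper left corner is `v`. -/
def block (v : Site N M) (a b : ℕ) : Finset (Site N M) :=
  Finset.univ.image fun p : Fin a × Fin b => (v.1 + ((p.1 : ℕ) : ZMod N), v.2 + ((p.2 : ℕ) : ZMod M))

/-- The `3 × 3` square centred at `v`. -/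
def square (v : Site N M) : Finset (Site N M) := block (v.1 - 1, v.2 - 1) 3 3

/-- The cross: `v` together with its nearest neighbours. -/
def cross (v : Site N M) : Finset (Site N M) :=
  {v, (v.1, v.2 - 1), (v.1, v.2 + 1), (v.1 - 1, v.2), (v.1 + 1, v.2)}

theorem block_mono (v : Site N M) {a b a' b' : ℕ} (ha : a ≤ a') (hb : b ≤ b') :
    block v a b ⊆ block v a' b' := by
  intro w hw
  simp only [block, Finset.mem_image, Finset.mem_univ, true_and] at hw ⊢
  obtain ⟨p, rfl⟩ := hw
  exact ⟨(⟨p.1, by omega⟩, ⟨p.2, by omega⟩), rfl⟩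

theorem block_right_subset (v : Site N M) (a b : ℕ) :
    block (v.1, v.2 + 1) a b ⊆ block v a (b + 1) := by
  intro w hw
  simp only [block, Finset.mem_image, Finset.mem_univ, true_and] at hw ⊢
  obtain ⟨p, rfl⟩ := hw
  refine ⟨(p.1, ⟨p.2 + 1, by omega⟩), ?_⟩
  ext <;> simp
  ring

theorem block_down_subset (v : Site N M) (a b : ℕ) :
    block (v.1 + 1, v.2) a b ⊆ block v (a + 1) b := by
  intro w hw
  simp only [block, Finset.mem_image, Finset.mem_univ, true_and] at hw ⊢
  obtain ⟨p, rfl⟩ := hw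
  refine ⟨(⟨p.1 + 1, by omega⟩, p.2), ?_⟩
  ext <;> simp
  ring

theorem cross_subset_square (v : Site N M) : cross v ⊆ square v := by
  intro w hw
  simp only [square, block, Finset.mem_image, Finset.mem_univ, true_and]
  simp only [cross, Finset.mem_insert, Finset.mem_singleton] at hw
  rcases hw with rfl | rfl | rfl | rfl | rfl
  · exact ⟨(1, 1), by ext <;> simp⟩
  · exact ⟨(1, 0), by ext <;> simp⟩
  · exact ⟨(1, 2), by ext <;> simp; ring⟩
  · exact ⟨(0, 1), by ext <;> simp⟩
  · exact ⟨(2, 1), by ext <;> simp; ring⟩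

/-- A region that does not wind around the torus: it misses a whole row and a whole column,
so it is (a copy of) a finite region of the infinite square lattice. -/
def IsPlanar (R : Finset (Site N M)) : Prop :=
  (∃ r, ∀ c, (r, c) ∉ R) ∧ (∃ c, ∀ r, (r, c) ∉ R)

variable [NeZero N] [NeZero M]

/-- Bonds with both end points in `R`. -/
def interiorBonds (R : Finset (Site N M)) : Finset (Bond N M) :=
  Finset.univ.filter fun e => endpoint e false ∈ R ∧ endpoint e true ∈ R

/-- Outgoing bonds of `R`: exactly one end point lies in `R`. -/
def boundaryBonds (R : Finset (Site N M)) : Finset (Bond N M) :=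
  Finset.univ.filter fun e =>
    (endpoint e false ∈ R ∧ endpoint e true ∉ R) ∨ (endpoint e false ∉ R ∧ endpoint e true ∈ R)

/-- Bonds with at least one end point in `R`. -/
def touchingBonds (R : Finset (Site N M)) : Finset (Bond N M) :=
  Finset.univ.filter fun e => endpoint e false ∈ R ∨ endpoint e true ∈ R

theorem boundaryBonds_subset (R : Finset (Site N M)) : boundaryBonds R ⊆ touchingBonds R := by
  intro e he
  simp only [boundaryBonds, touchingBonds, Finset.mem_filter, Finset.mem_univ, true_and] at he ⊢
  tauto

theorem leftBond_mem {R : Finset (Site N M)} {v : Site N M} (hv : v ∈ R) :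
    leftBond v ∈ touchingBonds R := by
  simp only [touchingBonds, Finset.mem_filter, Finset.mem_univ, true_and]
  simp [leftBond, endpoint, hv]

theorem rightBond_mem {R : Finset (Site N M)} {v : Site N M} (hv : v ∈ R) :
    rightBond v ∈ touchingBonds R := by
  simp only [touchingBonds, Finset.mem_filter, Finset.mem_univ, true_and]
  simp [rightBond, endpoint, hv]

theorem upBond_mem {R : Finset (Site N M)} {v : Site N M} (hv : v ∈ R) :
    upBond v ∈ touchingBonds R := by
  simp only [touchingBonds, Finset.mem_filter, Finset.mem_univ, true_and]
  simp [upBond, endpoint, hv]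

theorem downBond_mem {R : Finset (Site N M)} {v : Site N M} (hv : v ∈ R) :
    downBond v ∈ touchingBonds R := by
  simp only [touchingBonds, Finset.mem_filter, Finset.mem_univ, true_and]
  simp [downBond, endpoint, hv]

/-! ### Hilbert spaces of regions and tensoring with the identity -/

/-- The Hilbert space of a set `ι` of sites with `d` levels each, with orthonormal basis
indexed by the configurations `ι → Fin d`. -/
abbrev Hilb (d : ℕ) (ι : Type) := EuclideanSpace ℂ (ι → Fin d)

variable {d D : ℕ} {ι κ : Type}

/-- For an inclusion `f` of a set `ι` of sites into `κ`, the component of `χ` along the basis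
vector `|y⟩` of the sites outside `ι` (the values of `y` on `ι` are not used). -/
def slice (f : ι → κ) (y : κ → Fin d) : Hilb d κ →ₗ[ℂ] Hilb d ι where
  toFun χ := WithLp.toLp 2 fun z => χ (Function.extend f z y)
  map_add' _ _ := by ext; simp
  map_smul' _ _ := by ext; simp

/-- `T ⊗ 𝟙` on the sites `κ`, for an operator `T` on the sites `ι`. -/
def ampliate (f : ι → κ) (T : Hilb d ι →ₗ[ℂ] Hilb d ι) : Hilb d κ →ₗ[ℂ] Hilb d κ where
  toFun χ := WithLp.toLp 2 fun x => T (slice f x χ) (x ∘ f)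
  map_add' _ _ := by ext; simp
  map_smul' _ _ := by ext; simp

/-- `G ⊗ ℋ` on the sites `κ`, for a subspace `G` on the sites `ι`: the vectors of the form
`∑ y, g y ⊗ |y⟩` with all `g y ∈ G`, where `y` runs over configurations outside `ι`. -/
def ampliateSpace (f : ι → κ) (G : Submodule ℂ (Hilb d ι)) : Submodule ℂ (Hilb d κ) :=
  ⨅ y : κ → Fin d, G.comap (slice f y)

/-- The inclusion of regions. -/
def incl {R S : Finset (Site N M)} (h : R ⊆ S) : R → S := fun v => ⟨v, h v.2⟩

/-! ### PEPS on the torus -/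

/-- Site tensors `A v i l r u d`: physical index `i`, virtual indices on the left, right, upper
and lower bond. -/
abbrev Tensors (N M d D : ℕ) :=
  Site N M → Fin d → Fin D → Fin D → Fin D → Fin D → ℂ

/-- The PEPS: contraction of all tensors along all bonds. -/
def state (A : Tensors N M d D) : Hilb d (Site N M) :=
  WithLp.toLp 2 fun x => ∑ k : Bond N M → Fin D,
    ∏ v, A v (x v) (k (leftBond v)) (k (rightBond v)) (k (upBond v)) (k (downBond v))

/-- The map `Γ_R` from tensors `C` on the outgoing bonds of `R` to the physical space of `R`:
contract all the tensors in `R` with each other and with `C`. -/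
def Gam (A : Tensors N M d D) (R : Finset (Site N M)) :
    ((boundaryBonds R → Fin D) → ℂ) →ₗ[ℂ] Hilb d R where
  toFun C := WithLp.toLp 2 fun x => ∑ k : touchingBonds R → Fin D,
    (∏ v : R, A v (x v) (k ⟨leftBond v.1, leftBond_mem v.2⟩)
      (k ⟨rightBond v.1, rightBond_mem v.2⟩) (k ⟨upBond v.1, upBond_mem v.2⟩)
      (k ⟨downBond v.1, downBond_mem v.2⟩)) *
    C fun e => k ⟨e.1, boundaryBonds_subset R e.2⟩
  map_add' _ _ := by ext; simp [mul_add, Finset.sum_add_distrib]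
  map_smul' _ _ := by
    ext
    simp only [Pi.smul_apply, smul_eq_mul, RingHom.id_apply, PiLp.smul_apply, Finset.mul_sum]
    exact Finset.sum_congr rfl fun _ _ => by ring

/-- The region `R` is injective. -/
def IsInjectiveRegion (A : Tensors N M d D) (R : Finset (Site N M)) : Prop :=
  Function.Injective (Gam A R)

/-- The PEPS is injective: the lattice is covered by disjoint (planar) injective regions. -/
def IsInjectivePEPS (A : Tensors N M d D) : Prop :=
  ∃ P : Finpartition (Finset.univ : Finset (Site N M)),
    ∀ R ∈ P.parts, IsPlanar R ∧ IsInjectiveRegion A R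

/-- `G_R`, the range of `Γ_R`. -/
def GSpace (A : Tensors N M d D) (R : Finset (Site N M)) : Submodule ℂ (Hilb d R) :=
  LinearMap.range (Gam A R)

/-- `P_R`, the orthogonal projection onto the orthogonal complement of `G_R`. -/
def parentProj (A : Tensors N M d D) (R : Finset (Site N M)) : Hilb d R →ₗ[ℂ] Hilb d R :=
  ((GSpace A R)ᗮ.starProjection : Hilb d R →L[ℂ] Hilb d R)

/-- The Hamiltonian `∑ v, h v ⊗ 𝟙` with the interaction `h v` acting on the region `R v`. -/
def hamiltonian (R : Site N M → Finset (Site N M))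
    (h : ∀ v, Hilb d (R v) →ₗ[ℂ] Hilb d (R v)) :
    Hilb d (Site N M) →ₗ[ℂ] Hilb d (Site N M) :=
  ∑ v, ampliate (Subtype.val : R v → Site N M) (h v)

/-- `R, h` is a parent Hamiltonian: every site is assigned a region containing it and its nearest
neighbours, and a positive interaction term whose kernel is the space `G` of that region. -/
structure IsParent (A : Tensors N M d D) (R : Site N M → Finset (Site N M))
    (h : ∀ v, Hilb d (R v) →ₗ[ℂ] Hilb d (R v)) : Prop where
  surrounds : ∀ v, cross v ⊆ R v
  positive : ∀ v, (h v).IsPositive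
  ker_eq : ∀ v, LinearMap.ker (h v) = GSpace A (R v)

/-- `ψ` is a ground state of the Hamiltonian `H`: a nonzero vector of minimal energy
`⟨ψ, H ψ⟩ / ⟨ψ, ψ⟩`. -/
def IsGroundState {𝕜 E : Type*} [RCLike 𝕜] [NormedAddCommGroup E] [InnerProductSpace 𝕜 E]
    (H : E →ₗ[𝕜] E) (ψ : E) : Prop :=
  ψ ≠ 0 ∧ ∀ χ : E,
    RCLike.re (inner 𝕜 ψ (H ψ)) * ‖χ‖ ^ 2 ≤ RCLike.re (inner 𝕜 χ (H χ)) * ‖ψ‖ ^ 2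

/-- `ψ` is the unique ground state of `H`, up to a scalar. -/
def IsUniqueGroundState {𝕜 E : Type*} [RCLike 𝕜] [NormedAddCommGroup E] [InnerProductSpace 𝕜 E]
    (H : E →ₗ[𝕜] E) (ψ : E) : Prop :=
  IsGroundState H ψ ∧ ∀ χ, IsGroundState H χ → ∃ c : 𝕜, χ = c • ψ

/-! ### PEPS of classical models -/

/-- For each bond `e` and each of its end points `b`, the `d × d` matrix `φ e b` with rows
`⟨φ_x|`, where `x` is the classical configuration of that end point. -/
abbrev BondMatrices (N M d : ℕ) := Bond N M → Bool → Matrix (Fin d) (Fin d) ℂ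

/-- The site tensors `A_{x; α} = ∏_e ⟨φ^e_x | α_e⟩`, product over the four bonds at the site. -/
def classicalTensors (φ : BondMatrices N M d) : Tensors N M d d :=
  fun v x l r u dn => φ (leftBond v) true x l * φ (rightBond v) false x r *
    φ (upBond v) true x u * φ (downBond v) false x dn

/-- The result of contracting the bond `e`, when its end points have configurations `x`, `y`. -/
def bondWeight (φ : BondMatrices N M d) (e : Bond N M) (x y : Fin d) : ℂ :=
  ∑ k, φ e false x k * φ e true y k

/-- `C(x)` for the region `R`: the result of the contractions along all the bonds inside `R`
(only the values of `x` on `R` matter). -/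
def contraction (φ : BondMatrices N M d) (R : Finset (Site N M)) (x : Site N M → Fin d) : ℂ :=
  ∏ e ∈ interiorBonds R, bondWeight φ e (x (endpoint e false)) (x (endpoint e true))

/-- The classical Hamiltonian `H(x) = ∑_{(i,j)} h_{ij}(x_i, x_j)`. -/
def energy (h : Bond N M → Fin d → Fin d → ℝ) (x : Site N M → Fin d) : ℝ :=
  ∑ e, h e (x (endpoint e false)) (x (endpoint e true))

/-- `φ` factorizes the Boltzmann weights `exp(-β h / 2)` of the classical model `h`. -/
def Factorizes (φ : BondMatrices N M d) (h : Bond N M → Fin d → Fin d → ℝ) (β : ℝ) : Prop :=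
  ∀ e x y, (Real.exp (-(β / 2) * h e x y) : ℂ) = bondWeight φ e x y

end

end PEPS

open PEPS

/-! Each matrix `φ e b` sits at one end of a bond, so contraction works bond by bond. For a region
`R`, `Gam_apply` writes `Γ_R C` at `x` as `contraction φ R x` times a function of the values of `x`
at the inner ends of the outgoing bonds. Invertibility of the `φ e b` makes that function arbitrary
(`boundaryMap_surjective`). Hence `f` lies in `G_R` iff `f / C_R` is unchanged by altering any site
`v` with `cross v ⊆ R` (`mem_GSpace_iff`).

Altering such a `v` affects only bonds inside `R`, so `C_R` may be replaced by the weight of the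
whole torus, which is `ψ` itself: `G_R ⊗ ℋ` becomes a condition on `χ / ψ` that involves `R` only
through its interior `{v | cross v ⊆ R}` (`mem_ampliateSpace_GSpace_iff`).

The consequences are then combinatorial. If the interiors cover the torus, `χ / ψ` is constant,
which gives uniqueness of the ground state. The intersection identities hold because the interior of
the large block is covered by those of the two small ones. The square and the cross have the same
interior, their centre. Injectivity fails because at a corner of `R` two outgoing bonds read the
same site, and boundary tensors supported on unequal readings are annihilated. -/

namespace PEPS

/-! ### Incidence of sites and bonds on the torus. -/

section Bonds

variable {N M : ℕ}

theorem endpoint_leftBond (v : Site N M) : endpoint (leftBond v) true = v := by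
  simp [endpoint, leftBond]

theorem endpoint_rightBond (v : Site N M) : endpoint (rightBond v) false = v := rfl

theorem endpoint_upBond (v : Site N M) : endpoint (upBond v) true = v := by
  simp [endpoint, upBond]

theorem endpoint_downBond (v : Site N M) : endpoint (downBond v) false = v := rfl

theorem mem_cross_self (v : Site N M) : v ∈ cross v := by simp [cross]

theorem endpoint_mem_cross (e : Bond N M) (b b' : Bool) :
    endpoint e b' ∈ cross (endpoint e b) := by
  obtain ⟨v, s⟩ := e
  cases b <;> cases b' <;> cases s <;> simp [endpoint, cross]

theorem exists_bond_of_mem_cross {v w : Site N M} (hw : w ∈ cross v) (hne : w ≠ v) :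
    ∃ e b, endpoint e b = v ∧ endpoint e (!b) = w := by
  simp only [cross, Finset.mem_insert, Finset.mem_singleton] at hw
  rcases hw with rfl | rfl | rfl | rfl | rfl
  · exact absurd rfl hne
  · exact ⟨leftBond v, true, endpoint_leftBond v, rfl⟩
  · exact ⟨rightBond v, false, rfl, rfl⟩
  · exact ⟨upBond v, true, endpoint_upBond v, rfl⟩
  · exact ⟨downBond v, false, rfl, rfl⟩

theorem mem_block {v w : Site N M} {a b : ℕ} :
    w ∈ block v a b ↔ ∃ i < a, ∃ j < b, w = (v.1 + (i : ZMod N), v.2 + (j : ZMod M)) := by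
  simp only [block, Finset.mem_image, Finset.mem_univ, true_and]
  constructor
  · rintro ⟨p, rfl⟩
    exact ⟨p.1, p.1.2, p.2, p.2.2, rfl⟩
  · rintro ⟨i, hi, j, hj, rfl⟩
    exact ⟨(⟨i, hi⟩, ⟨j, hj⟩), rfl⟩

variable [NeZero N] [NeZero M]

/-- A product over the four bond ends at the sites of `R`, as a product over bonds. -/
theorem prod_sites_eq_prod_bonds (R : Finset (Site N M)) (a : Bond N M → Bool → ℂ) :
    ∏ v ∈ R, (a (leftBond v) true * a (rightBond v) false * a (upBond v) true *
        a (downBond v) false) =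
      ∏ e, ((if endpoint e false ∈ R then a e false else 1) *
        (if endpoint e true ∈ R then a e true else 1)) := by
  have hl : ∏ v ∈ R, a (leftBond v) true =
      ∏ v : Site N M, if endpoint (v, false) true ∈ R then a (v, false) true else 1 := by
    rw [← Finset.prod_filter]
    refine Finset.prod_bij' (fun v _ => (v.1, v.2 - 1)) (fun v _ => (v.1, v.2 + 1)) ?_ ?_ ?_ ?_ ?_
      <;> simp [endpoint, leftBond]
  have hu : ∏ v ∈ R, a (upBond v) true =
      ∏ v : Site N M, if endpoint (v, true) true ∈ R then a (v, true) true else 1 := by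
    rw [← Finset.prod_filter]
    refine Finset.prod_bij' (fun v _ => (v.1 - 1, v.2)) (fun v _ => (v.1 + 1, v.2)) ?_ ?_ ?_ ?_ ?_
      <;> simp [endpoint, upBond]
  have hr : ∏ v ∈ R, a (rightBond v) false =
      ∏ v : Site N M, if endpoint (v, false) false ∈ R then a (v, false) false else 1 := by
    rw [← Finset.prod_filter]
    exact Finset.prod_congr (Finset.ext fun v => ⟨fun h => Finset.mem_filter.2 ⟨Finset.mem_univ _, h⟩,
      fun h => (Finset.mem_filter.1 h).2⟩) fun _ _ => rfl
  have hd : ∏ v ∈ R, a (downBond v) false =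
      ∏ v : Site N M, if endpoint (v, true) false ∈ R then a (v, true) false else 1 := by
    rw [← Finset.prod_filter]
    exact Finset.prod_congr (Finset.ext fun v => ⟨fun h => Finset.mem_filter.2 ⟨Finset.mem_univ _, h⟩,
      fun h => (Finset.mem_filter.1 h).2⟩) fun _ _ => rfl
  rw [Fintype.prod_prod_type]
  simp only [Fintype.prod_bool, Finset.prod_mul_distrib, hl, hu, hr, hd]
  ring

/-- The end of an outgoing bond of `R` that lies in `R`. -/
def innerEnd (R : Finset (Site N M)) (e : Bond N M) : Bool := !decide (endpoint e false ∈ R)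

/-- The site of `R` at an outgoing bond of `R`. -/
def innerSite (R : Finset (Site N M)) (e : boundaryBonds R) : Site N M :=
  endpoint e.1 (innerEnd R e.1)

theorem mem_boundaryBonds_iff {R : Finset (Site N M)} {e : Bond N M} {b : Bool} :
    e ∈ boundaryBonds R ↔
      (endpoint e b ∈ R ∧ endpoint e (!b) ∉ R) ∨ (endpoint e b ∉ R ∧ endpoint e (!b) ∈ R) := by
  cases b <;> simp only [boundaryBonds, Finset.mem_filter, Finset.mem_univ, true_and,
    Bool.not_true, Bool.not_false]
  tauto

theorem mem_boundaryBonds_of {R : Finset (Site N M)} {e : Bond N M} {b : Bool}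
    (h : endpoint e b ∈ R) (h' : endpoint e (!b) ∉ R) : e ∈ boundaryBonds R :=
  mem_boundaryBonds_iff.2 (Or.inl ⟨h, h'⟩)

theorem innerSite_eq {R : Finset (Site N M)} {e : Bond N M} {b : Bool}
    (h : endpoint e b ∈ R) (h' : endpoint e (!b) ∉ R) :
    innerSite R ⟨e, mem_boundaryBonds_of h h'⟩ = endpoint e b := by
  cases b
  · have h1 : endpoint e false ∈ R := h
    simp [innerSite, innerEnd, h1]
  · have h1 : endpoint e false ∉ R := h'
    simp [innerSite, innerEnd, h1]

theorem innerSite_mem {R : Finset (Site N M)} (e : boundaryBonds R) : innerSite R e ∈ R := by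
  obtain ⟨e, he⟩ := e
  rcases (mem_boundaryBonds_iff (b := false)).1 he with h | h
  · rw [innerSite_eq h.1 h.2]; exact h.1
  · rw [innerSite_eq (b := true) h.2 h.1]; exact h.2

theorem not_cross_innerSite_subset {R : Finset (Site N M)} (e : boundaryBonds R) :
    ¬ cross (innerSite R e) ⊆ R := by
  intro hc
  have h := (mem_boundaryBonds_iff (b := innerEnd R e.1)).1 e.2
  have h1 : endpoint e.1 (!innerEnd R e.1) ∈ R := hc (endpoint_mem_cross _ _ _)
  have h2 : endpoint e.1 (innerEnd R e.1) ∈ R := innerSite_mem e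
  tauto

theorem exists_innerSite_eq {R : Finset (Site N M)} {v : Site N M} (hv : v ∈ R)
    (hc : ¬ cross v ⊆ R) : ∃ e, innerSite R e = v := by
  obtain ⟨w, hw, hwR⟩ := Finset.not_subset.1 hc
  obtain ⟨e, b, rfl, rfl⟩ := exists_bond_of_mem_cross hw (by rintro rfl; exact hwR hv)
  exact ⟨_, innerSite_eq hv hwR⟩

theorem touchingBonds_sdiff (R : Finset (Site N M)) :
    touchingBonds R \ boundaryBonds R = interiorBonds R := by
  ext e
  simp only [interiorBonds, touchingBonds, boundaryBonds, Finset.mem_sdiff, Finset.mem_filter,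
    Finset.mem_univ, true_and]
  tauto

end Bonds

/-! ### Factorization of contractions over bonds. -/

section Contraction

variable {N M d : ℕ} [NeZero N] [NeZero M] (φ : BondMatrices N M d)

theorem state_eq_contraction (x : Site N M → Fin d) :
    state (classicalTensors φ) x = contraction φ Finset.univ x := by
  have h : ∀ k : Bond N M → Fin d,
      (∏ v, classicalTensors φ v (x v) (k (leftBond v)) (k (rightBond v)) (k (upBond v))
        (k (downBond v))) =
      ∏ e, φ e false (x (endpoint e false)) (k e) * φ e true (x (endpoint e true)) (k e) := by
    intro k
    have := prod_sites_eq_prod_bonds Finset.univ fun e b => φ e b (x (endpoint e b)) (k e)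
    simpa only [classicalTensors, endpoint_leftBond, endpoint_rightBond, endpoint_upBond, endpoint_downBond,
      Finset.mem_univ, if_true] using this
  simp only [state, h, contraction, bondWeight, interiorBonds, Finset.mem_univ, and_self,
    Finset.filter_true, Finset.prod_univ_sum, Fintype.piFinset_univ]

/-- The virtual boundary tensor, read off in terms of the sites at the outgoing bonds. -/
def boundaryMap (R : Finset (Site N M)) (C : (boundaryBonds R → Fin d) → ℂ)
    (y : boundaryBonds R → Fin d) : ℂ :=
  ∑ k, (∏ e : boundaryBonds R, φ e.1 (innerEnd R e.1) (y e) (k e)) * C k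

theorem prod_sites_region (R : Finset (Site N M)) (x : Site N M → Fin d)
    (k : touchingBonds R → Fin d) :
    (∏ v : R, classicalTensors φ v (x v) (k ⟨leftBond v.1, leftBond_mem v.2⟩)
      (k ⟨rightBond v.1, rightBond_mem v.2⟩) (k ⟨upBond v.1, upBond_mem v.2⟩)
      (k ⟨downBond v.1, downBond_mem v.2⟩)) =
    ∏ e : touchingBonds R,
      ((if endpoint e.1 false ∈ R then φ e.1 false (x (endpoint e.1 false)) (k e) else 1) *
        (if endpoint e.1 true ∈ R then φ e.1 true (x (endpoint e.1 true)) (k e) else 1)) := by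
  rcases R.eq_empty_or_nonempty with rfl | ⟨v₀, hv₀⟩
  · simp
  -- The filler `x v₀` is harmless: bonds that do not touch `R` contribute the factor 1.
  obtain ⟨K, hK⟩ : ∃ K : Bond N M → Fin d, ∀ e : touchingBonds R, k e = K e :=
    ⟨Function.extend Subtype.val k fun _ => x v₀,
      fun e => (Subtype.val_injective.extend_apply _ _ _).symm⟩
  have h := prod_sites_eq_prod_bonds R fun e b => φ e b (x (endpoint e b)) (K e)
  simp only [endpoint_leftBond, endpoint_rightBond, endpoint_upBond, endpoint_downBond] at h
  simp only [hK, classicalTensors]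
  rw [Finset.prod_coe_sort R fun v => φ (leftBond v) true (x v) (K (leftBond v)) *
    φ (rightBond v) false (x v) (K (rightBond v)) * φ (upBond v) true (x v) (K (upBond v)) *
    φ (downBond v) false (x v) (K (downBond v)), h,
    Finset.prod_coe_sort (touchingBonds R) fun e =>
      ((if endpoint e false ∈ R then φ e false (x (endpoint e false)) (K e) else 1) *
        (if endpoint e true ∈ R then φ e true (x (endpoint e true)) (K e) else 1))]
  refine (Finset.prod_subset (Finset.subset_univ _) fun e _ he => ?_).symm
  simp only [touchingBonds, Finset.mem_filter, Finset.mem_univ, true_and, not_or] at he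
  simp [he.1, he.2]

/-- Once the boundary indices are fixed, the sum over virtual indices splits into one sum per bond:
interior bonds give their weights, outgoing bonds leave the matrix at their inner end. -/
theorem Gam_apply (R : Finset (Site N M)) (C : (boundaryBonds R → Fin d) → ℂ)
    (x : Site N M → Fin d) :
    Gam (classicalTensors φ) R C (fun v => x v) =
      contraction φ R x * boundaryMap φ R C fun e => x (innerSite R e) := by
  let g : Bond N M → Fin d → ℂ := fun e i =>
    (if endpoint e false ∈ R then φ e false (x (endpoint e false)) i else 1) *
      (if endpoint e true ∈ R then φ e true (x (endpoint e true)) i else 1)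
  -- Expansion of `C` in delta functions, each written as a product over bonds so that the sum over
  -- `k` can factorize.
  have hC : ∀ k : touchingBonds R → Fin d,
      C (fun e => k ⟨e.1, boundaryBonds_subset R e.2⟩) = ∑ κ : boundaryBonds R → Fin d, C κ *
        ∏ e : touchingBonds R, if h : e.1 ∈ boundaryBonds R then
          (if k e = κ ⟨e.1, h⟩ then 1 else 0) else 1 := by
    intro k
    rw [Finset.sum_eq_single fun e => k ⟨e.1, boundaryBonds_subset R e.2⟩]
    · simp
    · intro κ _ hκ
      obtain ⟨e, he⟩ := Function.ne_iff.1 hκ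
      rw [Finset.prod_eq_zero (Finset.mem_univ ⟨e.1, boundaryBonds_subset R e.2⟩), mul_zero]
      rw [dif_pos e.2, if_neg (Ne.symm he)]
    · simp
  have hsum : ∀ κ : boundaryBonds R → Fin d, ∀ e : touchingBonds R,
      (∑ i, g e.1 i * if h : e.1 ∈ boundaryBonds R then
          (if i = κ ⟨e.1, h⟩ then (1 : ℂ) else 0) else 1) =
        if h : e.1 ∈ boundaryBonds R then
          φ e.1 (innerEnd R e.1) (x (endpoint e.1 (innerEnd R e.1))) (κ ⟨e.1, h⟩)
        else bondWeight φ e.1 (x (endpoint e.1 false)) (x (endpoint e.1 true)) := by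
    rintro κ ⟨e, he⟩
    by_cases h : e ∈ boundaryBonds R
    · simp only [h, dif_pos, mul_ite, mul_one, mul_zero, Finset.sum_ite_eq', Finset.mem_univ,
        if_true]
      rcases (mem_boundaryBonds_iff (b := false)).1 h with h | h
      · have h2 : endpoint e true ∉ R := h.2
        simp [g, innerEnd, h.1, h2]
      · have h2 : endpoint e true ∈ R := h.2
        simp [g, innerEnd, h.1, h2]
    · have hi : e ∈ interiorBonds R := by
        rw [← touchingBonds_sdiff]; exact Finset.mem_sdiff.2 ⟨he, h⟩
      simp only [interiorBonds, Finset.mem_filter, Finset.mem_univ, true_and] at hi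
      simp [h, g, hi.1, hi.2, bondWeight]
  have hprod : ∀ κ : boundaryBonds R → Fin d,
      (∏ e : touchingBonds R, if h : e.1 ∈ boundaryBonds R then
          φ e.1 (innerEnd R e.1) (x (endpoint e.1 (innerEnd R e.1))) (κ ⟨e.1, h⟩)
        else bondWeight φ e.1 (x (endpoint e.1 false)) (x (endpoint e.1 true))) =
      contraction φ R x *
        ∏ e : boundaryBonds R, φ e.1 (innerEnd R e.1) (x (innerSite R e)) (κ e) := by
    intro κ
    rw [Finset.prod_coe_sort (touchingBonds R) fun e => if h : e ∈ boundaryBonds R then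
          φ e (innerEnd R e) (x (endpoint e (innerEnd R e))) (κ ⟨e, h⟩)
        else bondWeight φ e (x (endpoint e false)) (x (endpoint e true)),
      ← Finset.prod_sdiff (boundaryBonds_subset R), touchingBonds_sdiff, contraction]
    congr 1
    · refine Finset.prod_congr rfl fun e he => dif_neg ?_
      rw [← touchingBonds_sdiff] at he
      exact (Finset.mem_sdiff.1 he).2
    · rw [← Finset.prod_coe_sort]
      exact Finset.prod_congr rfl fun e _ => dif_pos e.2
  calc Gam (classicalTensors φ) R C (fun v => x v)
      = ∑ k : touchingBonds R → Fin d, (∏ e : touchingBonds R, g e.1 (k e)) *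
          C fun e => k ⟨e.1, boundaryBonds_subset R e.2⟩ :=
        Finset.sum_congr rfl fun k _ => by rw [prod_sites_region φ R x k]
    _ = ∑ κ : boundaryBonds R → Fin d, C κ * ∑ k : touchingBonds R → Fin d,
          ∏ e : touchingBonds R, (g e.1 (k e) * if h : e.1 ∈ boundaryBonds R then
            (if k e = κ ⟨e.1, h⟩ then 1 else 0) else 1) := by
        simp only [hC, Finset.mul_sum, Finset.prod_mul_distrib]
        rw [Finset.sum_comm]
        exact Finset.sum_congr rfl fun _ _ => Finset.sum_congr rfl fun _ _ => by ring
    _ = ∑ κ : boundaryBonds R → Fin d, C κ * (contraction φ R x *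
          ∏ e : boundaryBonds R, φ e.1 (innerEnd R e.1) (x (innerSite R e)) (κ e)) := by
        refine Finset.sum_congr rfl fun κ _ => ?_
        rw [← hprod, ← Finset.prod_congr rfl fun e _ => hsum κ e, Finset.prod_univ_sum,
          Fintype.piFinset_univ]
    _ = _ := by
        rw [boundaryMap, Finset.mul_sum]
        exact Finset.sum_congr rfl fun _ _ => by ring

/-- A tensor product of invertible matrices has the tensor product of their right inverses as a
right inverse. -/
theorem tensor_surjective {ι : Type*} [Fintype ι] [DecidableEq ι]
    (A : ι → Matrix (Fin d) (Fin d) ℂ) (hA : ∀ i, IsUnit (A i)) (F : (ι → Fin d) → ℂ) :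
    ∃ C : (ι → Fin d) → ℂ, ∀ y, ∑ k, (∏ i, A i (y i) (k i)) * C k = F y := by
  choose B hB using fun i => (hA i).exists_right_inv
  refine ⟨fun k => ∑ y, (∏ i, B i (k i) (y i)) * F y, fun y => ?_⟩
  have h : ∀ y', ∑ k : ι → Fin d, (∏ i, A i (y i) (k i)) * ∏ i, B i (k i) (y' i) =
      if y = y' then 1 else 0 := by
    intro y'
    simp only [← Finset.prod_mul_distrib]
    rw [← Fintype.piFinset_univ,
      ← Finset.prod_univ_sum (fun _ => Finset.univ) fun i j => A i (y i) j * B i j (y' i)]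
    simp only [← Matrix.mul_apply, hB, Matrix.one_apply]
    split_ifs with hy
    · simp [hy]
    · obtain ⟨i, hi⟩ := Function.ne_iff.1 hy
      exact Finset.prod_eq_zero (Finset.mem_univ i) (if_neg hi)
  simp only [Finset.mul_sum, ← mul_assoc]
  rw [Finset.sum_comm]
  simp only [← Finset.sum_mul, h]
  simp

theorem boundaryMap_surjective (hφ : ∀ e b, IsUnit (φ e b)) (R : Finset (Site N M)) :
    Function.Surjective (boundaryMap φ R) := fun F =>
  (tensor_surjective (fun e : boundaryBonds R => φ e.1 (innerEnd R e.1)) (fun _ => hφ _ _) F).imp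
    fun _ h => funext h

theorem contraction_congr {R : Finset (Site N M)} {x y : Site N M → Fin d}
    (h : ∀ v ∈ R, x v = y v) : contraction φ R x = contraction φ R y := by
  refine Finset.prod_congr rfl fun e he => ?_
  simp only [interiorBonds, Finset.mem_filter, Finset.mem_univ, true_and] at he
  rw [h _ he.1, h _ he.2]

/-- Every bond at `v` lies inside `R`, so the bonds outside contribute the same factor before and
after the update. The cross-multiplied form needs no division. -/
theorem contraction_update {R : Finset (Site N M)} {v : Site N M} (hv : cross v ⊆ R)
    (x : Site N M → Fin d) (a : Fin d) :
    contraction φ R (Function.update x v a) * contraction φ Finset.univ x =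
      contraction φ R x * contraction φ Finset.univ (Function.update x v a) := by
  have hsub : interiorBonds R ⊆ interiorBonds Finset.univ := by
    intro e; simp [interiorBonds]
  have hrest : ∀ e ∈ interiorBonds Finset.univ \ interiorBonds R, ∀ b, endpoint e b ≠ v := by
    rintro e he b rfl
    refine (Finset.mem_sdiff.1 he).2 ?_
    simp only [interiorBonds, Finset.mem_filter, Finset.mem_univ, true_and]
    exact ⟨hv (endpoint_mem_cross _ _ _), hv (endpoint_mem_cross _ _ _)⟩
  have hrest' : ∏ e ∈ interiorBonds Finset.univ \ interiorBonds R, bondWeight φ e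
        (Function.update x v a (endpoint e false)) (Function.update x v a (endpoint e true)) =
      ∏ e ∈ interiorBonds Finset.univ \ interiorBonds R,
        bondWeight φ e (x (endpoint e false)) (x (endpoint e true)) :=
    Finset.prod_congr rfl fun e he => by
      rw [Function.update_of_ne (hrest e he _), Function.update_of_ne (hrest e he _)]
  unfold contraction
  rw [← Finset.prod_sdiff hsub, ← Finset.prod_sdiff hsub, hrest']
  ring

end Contraction

/-- Finitely many sites can be changed one at a time; `A` is the set of irrelevant ones. -/
theorem eq_of_update_invariant {ι α β : Type*} [Fintype ι] [DecidableEq ι] (Q : (ι → α) → β)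
    (A : Set ι) (hQ : ∀ v ∈ A, ∀ x a, Q (Function.update x v a) = Q x) {x y : ι → α}
    (h : ∀ v ∉ A, x v = y v) : Q x = Q y := by
  have key : ∀ T : Finset ι, Q (T.piecewise x y) = Q y := by
    intro T
    induction T using Finset.induction_on with
    | empty => simp
    | insert v T _ ih =>
      rw [Finset.piecewise_insert]
      by_cases hv : v ∈ A
      · rw [hQ v hv, ih]
      · rw [Function.update_eq_self_iff.2, ih]
        by_cases hT : v ∈ T <;> simp [hT, h v hv]
  simpa using key Finset.univ

/-! ### The range of `Γ_R` as an invariance condition. -/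

section Ranges

variable {N M d : ℕ} [NeZero N] [NeZero M] {φ : BondMatrices N M d}

theorem mem_GSpace_iff [NeZero d] (hφ : ∀ e b, IsUnit (φ e b))
    (hC : ∀ (R : Finset (Site N M)) (x : Site N M → Fin d), contraction φ R x ≠ 0)
    (R : Finset (Site N M)) (f : Hilb d R) :
    f ∈ GSpace (classicalTensors φ) R ↔ ∀ v, cross v ⊆ R → ∀ (x : Site N M → Fin d) (a : Fin d),
      f (fun w => Function.update x v a w) / contraction φ R (Function.update x v a) =
        f (fun w => x w) / contraction φ R x := by
  constructor
  · rintro ⟨C, rfl⟩ v hv x a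
    rw [Gam_apply, Gam_apply, mul_div_cancel_left₀ _ (hC _ _), mul_div_cancel_left₀ _ (hC _ _)]
    congr 1
    ext1 e
    rw [Function.update_of_ne]
    rintro rfl
    exact not_cross_innerSite_subset e hv
  · intro h
    let Q : (Site N M → Fin d) → ℂ := fun x => f (fun w => x w) / contraction φ R x
    have hQ : ∀ x y : Site N M → Fin d, (∀ e, x (innerSite R e) = y (innerSite R e)) →
        Q x = Q y := by
      intro x y hxy
      -- Irrelevant sites are of two kinds: interior ones, by assumption, and those outside `R`,
      -- which neither `f` nor `C_R` reads.
      refine eq_of_update_invariant Q (Set.range (innerSite R))ᶜ ?_ ?_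
      · intro v hv x a
        by_cases hvR : v ∈ R
        · refine h v ?_ x a
          by_contra hc
          exact hv (exists_innerSite_eq hvR hc)
        · have hw : ∀ w ∈ R, Function.update x v a w = x w := fun w hw =>
            Function.update_of_ne (by rintro rfl; exact hvR hw) _ _
          simp only [Q]
          rw [contraction_congr φ hw, funext fun w : R => hw w.1 w.2]
      · intro v hv
        obtain ⟨e, rfl⟩ := not_not.1 hv
        exact hxy e
    -- Several outgoing bonds may share an inner site, and `Function.extend` then picks one of their
    -- values. Only boundary configurations `x ∘ innerSite R` are ever evaluated, and for these the
    -- values agree.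
    obtain ⟨C, hCF⟩ := boundaryMap_surjective φ hφ R
      fun y => Q (Function.extend (innerSite R) y fun _ => 0)
    refine ⟨C, ?_⟩
    ext z
    obtain ⟨x, rfl⟩ : ∃ x : Site N M → Fin d, z = fun w => x w.1 :=
      ⟨Function.extend Subtype.val z fun _ => 0,
        funext fun w => (Subtype.val_injective.extend_apply _ _ _).symm⟩
    rw [Gam_apply, hCF]
    beta_reduce
    rw [hQ (Function.extend (innerSite R) (fun e => x (innerSite R e)) fun _ => 0) x]
    · exact mul_div_cancel₀ _ (hC _ _)
    · intro e
      have he : ∃ e', innerSite R e' = innerSite R e := ⟨e, rfl⟩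
      rw [Function.extend_def, dif_pos he, he.choose_spec]

end Ranges

/-! ### Slices and tensoring with the identity. -/

section Ampliation

variable {ι κ : Type} {d : ℕ}

theorem slice_extend {f : ι → κ} (hf : Function.Injective f) (y : κ → Fin d) (z : ι → Fin d) :
    slice f (Function.extend f z y) = slice f y := by
  ext χ w
  refine congrArg χ.ofLp (funext fun v => ?_)
  by_cases h : ∃ i, f i = v
  · obtain ⟨i, rfl⟩ := h
    rw [hf.extend_apply, hf.extend_apply]
  · rw [Function.extend_apply' _ _ _ h, Function.extend_apply' _ _ _ h,
      Function.extend_apply' _ _ _ h]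

/-- This reduces questions about `T ⊗ 𝟙` to questions about `T` on each slice. -/
theorem slice_ampliate {f : ι → κ} (hf : Function.Injective f) (T : Hilb d ι →ₗ[ℂ] Hilb d ι)
    (y : κ → Fin d) (χ : Hilb d κ) : slice f y (ampliate f T χ) = T (slice f y χ) := by
  ext z
  change T (slice f (Function.extend f z y) χ) (Function.extend f z y ∘ f) = _
  rw [slice_extend hf, show Function.extend f z y ∘ f = z from
    funext fun i => hf.extend_apply _ _ _]

theorem mem_ampliateSpace {f : ι → κ} {G : Submodule ℂ (Hilb d ι)} {χ : Hilb d κ} :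
    χ ∈ ampliateSpace f G ↔ ∀ y, slice f y χ ∈ G := by
  simp [ampliateSpace]

variable [Fintype ι] [Fintype κ] [DecidableEq ι] [DecidableEq κ]

/-- The values of `y` on `ι` are redundant, so each configuration is counted once per configuration
of `ι`. Exchanging `z` with the values of `y` on `ι` is an involution that makes this visible. -/
theorem sum_extend {f : ι → κ} (hf : Function.Injective f) (F : (κ → Fin d) → ℂ) :
    ∑ y : κ → Fin d, ∑ z : ι → Fin d, F (Function.extend f z y) =
      Fintype.card (ι → Fin d) * ∑ x, F x := by
  have hinv : Function.Involutive fun p : (κ → Fin d) × (ι → Fin d) =>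
      (Function.extend f p.2 p.1, p.1 ∘ f) := by
    rintro ⟨y, z⟩
    refine Prod.ext (funext fun v => ?_) (funext fun i => hf.extend_apply _ _ _)
    by_cases h : ∃ i, f i = v
    · obtain ⟨i, rfl⟩ := h
      exact hf.extend_apply _ _ _
    · exact (Function.extend_apply' _ _ _ h).trans (Function.extend_apply' _ _ _ h)
  rw [← Fintype.sum_prod_type' fun y z => F (Function.extend f z y),
    show ∑ p : (κ → Fin d) × (ι → Fin d), F (Function.extend f p.2 p.1) =
        ∑ p : (κ → Fin d) × (ι → Fin d), F p.1 from
      Equiv.sum_comp hinv.toPerm fun p => F p.1, Fintype.sum_prod_type]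
  simp [Finset.mul_sum]

theorem sum_inner_slice {f : ι → κ} (hf : Function.Injective f) (χ ξ : Hilb d κ) :
    ∑ y, inner ℂ (slice f y χ) (slice f y ξ) = Fintype.card (ι → Fin d) * inner ℂ χ ξ := by
  simp only [PiLp.inner_apply]
  exact sum_extend hf fun x => inner ℂ (χ x) (ξ x)

theorem sum_inner_slice_ampliate {f : ι → κ} (hf : Function.Injective f)
    (T : Hilb d ι →ₗ[ℂ] Hilb d ι) (χ : Hilb d κ) :
    ∑ y, RCLike.re (inner ℂ (slice f y χ) (T (slice f y χ))) =
      Fintype.card (ι → Fin d) * RCLike.re (inner ℂ χ (ampliate f T χ)) := by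
  have h := congrArg RCLike.re (sum_inner_slice hf χ (ampliate f T χ))
  simp only [slice_ampliate hf, map_sum] at h
  rw [h, ← Complex.ofReal_natCast]
  exact Complex.re_ofReal_mul _ _

/-- `(G ⊗ ℋ)ᗮ` is projected onto by the ampliation of the projection onto `Gᗮ`. -/
theorem starProjection_orthogonal_ampliateSpace {f : ι → κ} (hf : Function.Injective f)
    {G : Submodule ℂ (Hilb d ι)} {G' : Submodule ℂ (Hilb d κ)} (hG : ampliateSpace f G = G')
    (χ : Hilb d κ) :
    G'ᗮ.starProjection χ = ampliate f (Gᗮ.starProjection : Hilb d ι →L[ℂ] Hilb d ι) χ := by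
  subst hG
  refine Submodule.eq_starProjection_of_mem_orthogonal ?_ ?_
  · rw [Submodule.mem_orthogonal]
    intro ξ hξ
    -- Without configurations of `ι` the overcounting factor is zero and cannot be cancelled, but
    -- then `Hilb d κ` is trivial as well.
    rcases isEmpty_or_nonempty (ι → Fin d) with hι | hι
    · have : IsEmpty (κ → Fin d) := ⟨fun x => hι.false (x ∘ f)⟩
      simp [PiLp.inner_apply]
    have h := sum_inner_slice hf ξ (ampliate f (Gᗮ.starProjection : Hilb d ι →L[ℂ] Hilb d ι) χ)
    rw [Finset.sum_eq_zero] at h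
    · exact (mul_eq_zero.1 h.symm).resolve_left (Nat.cast_ne_zero.2 Fintype.card_ne_zero)
    · intro y _
      rw [slice_ampliate hf]
      exact (Submodule.mem_orthogonal _ _).1 (Submodule.starProjection_apply_mem _ _) _
        (mem_ampliateSpace.1 hξ y)
  · refine Submodule.le_orthogonal_orthogonal _ (mem_ampliateSpace.2 fun y => ?_)
    rw [map_sub, slice_ampliate hf]
    have := Submodule.sub_starProjection_mem_orthogonal (K := Gᗮ) (slice f y χ)
    rwa [Submodule.orthogonal_orthogonal] at this

end Ampliation

/-! ### Vectors of zero energy for a positive operator. -/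

section Positivity

variable {E : Type*} [NormedAddCommGroup E] [InnerProductSpace ℂ E]

/-- The energy of `s + t • T s` has no constant term in `t`; its linear coefficient `2‖T s‖²` must
vanish, or it would be negative for small negative `t`. -/
theorem apply_eq_zero_of_re_inner_eq_zero {T : E →ₗ[ℂ] E} (hT : T.IsPositive) {s : E}
    (hs : RCLike.re (inner ℂ s (T s)) = 0) : T s = 0 := by
  set a : ℝ := RCLike.re (inner ℂ (T s) (T (T s))) with ha
  have ha0 : 0 ≤ a := hT.re_inner_nonneg_right _
  have hq : ∀ t : ℝ, 0 ≤ 2 * t * ‖T s‖ ^ 2 + t ^ 2 * a := by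
    intro t
    have h := hT.re_inner_nonneg_right (s + (t : ℂ) • T s)
    have h1 : inner ℂ s (T (T s)) = inner ℂ (T s) (T s) := (hT.isSymmetric s (T s)).symm
    have h2 : RCLike.re (inner ℂ (T s) (T s)) = ‖T s‖ ^ 2 := inner_self_eq_norm_sq (𝕜 := ℂ) _
    have h3 : RCLike.re (inner ℂ (s + (t : ℂ) • T s) (T (s + (t : ℂ) • T s))) =
        2 * t * ‖T s‖ ^ 2 + t ^ 2 * a := by
      rw [ha, ← h2]
      simp only [map_add, map_smul, inner_add_left, inner_add_right, inner_smul_left,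
        inner_smul_right, h1, Complex.conj_ofReal, hs]
      simp only [RCLike.re_to_complex, Complex.add_re, Complex.re_ofReal_mul]
      ring
    rwa [h3] at h
  -- The `+ 1` keeps the denominator positive when `a = 0`.
  have h := hq (-‖T s‖ ^ 2 / (a + 1))
  have h4 : 2 * (-‖T s‖ ^ 2 / (a + 1)) * ‖T s‖ ^ 2 + (-‖T s‖ ^ 2 / (a + 1)) ^ 2 * a =
      -(‖T s‖ ^ 2 / (a + 1)) ^ 2 * (a + 2) := by
    field_simp
    ring
  have h5 : (‖T s‖ ^ 2 / (a + 1)) ^ 2 = 0 := by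
    rw [h4] at h
    nlinarith [sq_nonneg (‖T s‖ ^ 2 / (a + 1))]
  have h6 : ‖T s‖ ^ 2 = 0 := by
    have := pow_eq_zero_iff (two_ne_zero) |>.1 h5
    exact (div_eq_zero_iff.1 this).resolve_right (by positivity)
  exact norm_eq_zero.1 ((pow_eq_zero_iff two_ne_zero).1 h6)

end Positivity

/-! ### Unique ground states of parent Hamiltonians. -/

section GroundState

variable {N M d : ℕ} [NeZero N] [NeZero M] {φ : BondMatrices N M d}

/-- `G_R ⊗ ℋ` consists of the vectors whose quotient by the PEPS does not depend on the
configuration of any site whose nearest neighbours all lie in `R`. -/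
theorem mem_ampliateSpace_GSpace_iff [NeZero d] (hφ : ∀ e b, IsUnit (φ e b))
    (hC : ∀ (R : Finset (Site N M)) (x : Site N M → Fin d), contraction φ R x ≠ 0)
    (R : Finset (Site N M)) {κ : Type} {f : R → κ} {j : κ → Site N M} (hj : Function.Injective j)
    (hf : ∀ v, j (f v) = v) (χ : Hilb d κ) :
    (∀ y, slice f y χ ∈ GSpace (classicalTensors φ) R) ↔
      ∀ v, cross v ⊆ R → ∀ (x : Site N M → Fin d) (a : Fin d),
        χ (fun w => Function.update x v a (j w)) /
            contraction φ Finset.univ (Function.update x v a) =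
          χ (fun w => x (j w)) / contraction φ Finset.univ x := by
  have hfi : Function.Injective f := fun v w h => Subtype.ext (by rw [← hf v, h, hf w])
  -- The update multiplies `C_R` and the global weight by the same ratio, so either may serve as the
  -- denominator.
  have hiff : ∀ v, cross v ⊆ R → ∀ (x : Site N M → Fin d) (a : Fin d) (p q : ℂ),
      p / contraction φ R (Function.update x v a) = q / contraction φ R x ↔
      p / contraction φ Finset.univ (Function.update x v a) =
        q / contraction φ Finset.univ x := by
    intro v hv x a p q
    have h := contraction_update φ hv x a
    rw [div_eq_div_iff (hC _ _) (hC _ _), div_eq_div_iff (hC _ _) (hC _ _)]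
    have h1 := hC R x
    have h2 := hC Finset.univ x
    constructor <;> intro h'
    · refine mul_left_cancel₀ h1 ?_
      linear_combination contraction φ Finset.univ x * h' + q * h
    · refine mul_left_cancel₀ h2 ?_
      linear_combination contraction φ R x * h' - q * h
  have hslice : ∀ y (x : Site N M → Fin d), slice f y χ (fun w => x w) =
      χ (Function.extend f (fun w => x w) y) := fun _ _ => rfl
  have hext : ∀ {z : Site N M → Fin d} {y x : κ → Fin d}, (∀ w, x (f w) = z w) →
      (∀ w, (¬ ∃ v, f v = w) → x w = y w) → Function.extend f (fun w : R => z w) y = x := by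
    intro z y x h1 h2
    ext1 w
    by_cases hw : ∃ v, f v = w
    · obtain ⟨v, rfl⟩ := hw
      rw [hfi.extend_apply, h1]
    · rw [Function.extend_apply' _ _ _ hw, h2 w hw]
  simp only [mem_GSpace_iff hφ hC]
  constructor
  · intro h v hv x a
    rw [← hiff v hv]
    have := h (fun w => x (j w)) v hv x a
    rw [hslice, hslice] at this
    rwa [hext (x := fun w => Function.update x v a (j w)), hext (x := fun w => x (j w))] at this
    · exact fun w => by rw [hf]
    · exact fun _ _ => rfl
    · exact fun w => by rw [hf]
    · intro w hw
      refine Function.update_of_ne ?_ _ _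
      rintro rfl
      exact hw ⟨⟨j w, hv (mem_cross_self _)⟩, hj (hf _)⟩
  · intro h y v hv x a
    -- The global weight needs a configuration of the whole torus: `x'` is `x` on `R`, `y` on the
    -- rest of `κ`, and `x` again outside `κ`.
    let x' : Site N M → Fin d := Function.extend j (Function.extend f (fun w => x w) y) x
    have hx' : ∀ w ∈ R, x' w = x w := by
      intro w hw
      have h1 : x' (j (f ⟨w, hw⟩)) = x w := by
        simp only [x']
        rw [hj.extend_apply, hfi.extend_apply]
      rwa [hf] at h1
    have hu : ∀ w ∈ R, Function.update x' v a w = Function.update x v a w := by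
      intro w hw
      by_cases hwv : w = v
      · subst hwv; simp
      · rw [Function.update_of_ne hwv, Function.update_of_ne hwv, hx' w hw]
    have h1 := (hiff v hv x' a _ _).2 (h v hv x' a)
    rw [contraction_congr φ hu, contraction_congr φ hx'] at h1
    have hx'j : ∀ w, x' (j w) = Function.extend f (fun w : R => x w) y w := fun w =>
      hj.extend_apply _ _ _
    rw [hslice, hslice, hext (x := fun w => Function.update x' v a (j w)), h1,
      hext (x := fun w => x' (j w))]
    · intro w
      rw [hf, hx' _ w.2]
    · intro w hw
      rw [hx'j, Function.extend_apply' _ _ _ hw]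
    · intro w
      rw [hf, hu _ w.2]
    · intro w hw
      rw [Function.update_of_ne, hx'j, Function.extend_apply' _ _ _ hw]
      rintro rfl
      exact hw ⟨⟨j w, hv (mem_cross_self _)⟩, hj (hf _)⟩

theorem state_ne_zero [NeZero d]
    (hC : ∀ (R : Finset (Site N M)) (x : Site N M → Fin d), contraction φ R x ≠ 0) :
    state (classicalTensors φ) ≠ 0 := fun h =>
  hC Finset.univ (fun _ => 0) (by rw [← state_eq_contraction, h]; rfl)

theorem IsParent.ampliate_state [NeZero d] (hφ : ∀ e b, IsUnit (φ e b))
    (hC : ∀ (R : Finset (Site N M)) (x : Site N M → Fin d), contraction φ R x ≠ 0)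
    {R : Site N M → Finset (Site N M)} {h : ∀ v, Hilb d (R v) →ₗ[ℂ] Hilb d (R v)}
    (hP : IsParent (classicalTensors φ) R h) (v : Site N M) :
    ampliate (Subtype.val : R v → Site N M) (h v) (state (classicalTensors φ)) = 0 := by
  have hmem := (mem_ampliateSpace_GSpace_iff hφ hC (R v) (f := Subtype.val)
    Function.injective_id (fun _ => rfl) (state (classicalTensors φ))).2 (by
      intro v _ x a
      simp only [id, state_eq_contraction]
      rw [div_self (hC _ _), div_self (hC _ _)])
  ext x
  have := hmem x
  rw [← hP.ker_eq, LinearMap.mem_ker] at this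
  change h v (slice Subtype.val x (state (classicalTensors φ))) _ = _
  rw [this]
  rfl

theorem IsParent.isUniqueGroundState [NeZero d] (hφ : ∀ e b, IsUnit (φ e b))
    (hC : ∀ (R : Finset (Site N M)) (x : Site N M → Fin d), contraction φ R x ≠ 0)
    {R : Site N M → Finset (Site N M)} {h : ∀ v, Hilb d (R v) →ₗ[ℂ] Hilb d (R v)}
    (hP : IsParent (classicalTensors φ) R h) :
    IsUniqueGroundState (hamiltonian R h) (state (classicalTensors φ)) := by
  have hψ := state_ne_zero hC
  have hHψ : hamiltonian R h (state (classicalTensors φ)) = 0 := by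
    rw [hamiltonian, LinearMap.sum_apply]
    exact Finset.sum_eq_zero fun v _ => hP.ampliate_state hφ hC v
  have hcard : ∀ v, (0 : ℝ) < Fintype.card (R v → Fin d) := fun v =>
    Nat.cast_pos.2 Fintype.card_pos
  have hterm : ∀ v (χ : Hilb d (Site N M)),
      0 ≤ RCLike.re (inner ℂ χ (ampliate (Subtype.val : R v → Site N M) (h v) χ)) := by
    intro v χ
    refine nonneg_of_mul_nonneg_right ?_ (hcard v)
    rw [← sum_inner_slice_ampliate Subtype.val_injective]
    exact Finset.sum_nonneg fun y _ => (hP.positive v).re_inner_nonneg_right _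
  have hsum : ∀ χ, RCLike.re (inner ℂ χ (hamiltonian R h χ)) =
      ∑ v, RCLike.re (inner ℂ χ (ampliate (Subtype.val : R v → Site N M) (h v) χ)) := by
    intro χ
    rw [hamiltonian, LinearMap.sum_apply, inner_sum, map_sum]
  refine ⟨⟨hψ, fun χ => ?_⟩, fun χ hχ => ?_⟩
  · rw [hHψ, inner_zero_right, map_zero, zero_mul, hsum]
    exact mul_nonneg (Finset.sum_nonneg fun v _ => hterm v χ) (sq_nonneg _)
  -- Comparison with `ψ`, whose energy is zero. All terms are nonnegative, so each one vanishes, and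
  -- within it each slice of `χ` has zero energy.
  have h0 : RCLike.re (inner ℂ χ (hamiltonian R h χ)) ≤ 0 := by
    have := hχ.2 (state (classicalTensors φ))
    rw [hHψ, inner_zero_right, map_zero, zero_mul] at this
    exact nonpos_of_mul_nonpos_left this (by positivity)
  rw [hsum] at h0
  have h1 := (Finset.sum_eq_zero_iff_of_nonneg fun v _ => hterm v χ).1
    (h0.antisymm (Finset.sum_nonneg fun v _ => hterm v χ))
  have h2 : ∀ v y, slice (Subtype.val : R v → Site N M) y χ ∈
      GSpace (classicalTensors φ) (R v) := by
    intro v y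
    have h3 := sum_inner_slice_ampliate (f := (Subtype.val : R v → Site N M))
      Subtype.val_injective (h v) χ
    rw [h1 v (Finset.mem_univ v), mul_zero] at h3
    rw [← hP.ker_eq, LinearMap.mem_ker]
    exact apply_eq_zero_of_re_inner_eq_zero (hP.positive v)
      ((Finset.sum_eq_zero_iff_of_nonneg fun y _ =>
        (hP.positive v).re_inner_nonneg_right _).1 h3 y (Finset.mem_univ y))
  -- The interiors of the `R v` exhaust the torus, so `χ / ψ` is constant and may be evaluated at
  -- any configuration.
  refine ⟨χ (fun _ => 0) / contraction φ Finset.univ fun _ => 0, ?_⟩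
  ext x
  have h4 := eq_of_update_invariant
    (fun x : Site N M → Fin d => χ x / contraction φ Finset.univ x) Set.univ
    (fun v _ x a => (mem_ampliateSpace_GSpace_iff hφ hC (R v) (f := Subtype.val)
      Function.injective_id (fun _ => rfl) χ).1 (h2 v) v (hP.surrounds v) x a)
    (x := x) (y := fun _ => 0) (fun v hv => absurd (Set.mem_univ v) hv)
  simp only at h4
  rw [PiLp.smul_apply, state_eq_contraction, smul_eq_mul, ← h4, div_mul_cancel₀ _ (hC _ _)]

theorem isParent_parentProj {R : Site N M → Finset (Site N M)} (hR : ∀ v, cross v ⊆ R v) :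
    IsParent (classicalTensors φ) R fun v => parentProj (classicalTensors φ) (R v) where
  surrounds := hR
  positive v := by
    refine ⟨Submodule.starProjection_isSymmetric _, fun x => ?_⟩
    exact Submodule.re_inner_starProjection_nonneg _ _
  ker_eq v := by
    refine (Submodule.ker_starProjection _).trans ?_
    rw [Submodule.orthogonal_orthogonal]

end GroundState

/-! ### Interiors of rectangular blocks. -/

section Blocks

variable {N M : ℕ}

theorem incl_injective {R S : Finset (Site N M)} (h : R ⊆ S) : Function.Injective (incl h) :=
  fun _ _ hvw => Subtype.ext (congrArg (fun w : S => w.1) hvw)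

theorem natCast_inj_of_lt {n i j : ℕ} (hi : i < n) (hj : j < n) (h : (i : ZMod n) = j) : i = j := by
  rwa [ZMod.natCast_eq_natCast_iff', Nat.mod_eq_of_lt hi, Nat.mod_eq_of_lt hj] at h

theorem exists_of_cross_subset_block {v w : Site N M} {a b : ℕ} (ha : a < N) (hb : b < M)
    (h : cross w ⊆ block v a b) :
    ∃ i j, 1 ≤ i ∧ i + 1 < a ∧ 1 ≤ j ∧ j + 1 < b ∧
      w = (v.1 + (i : ZMod N), v.2 + (j : ZMod M)) := by
  obtain ⟨i, hi, j, hj, rfl⟩ := mem_block.1 (h (mem_cross_self w))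
  obtain ⟨i₁, hi₁, _, _, h₁⟩ := mem_block.1 (h (show
    (v.1 + (i : ZMod N) - 1, v.2 + (j : ZMod M)) ∈ _ by simp [cross]))
  obtain ⟨i₂, hi₂, _, _, h₂⟩ := mem_block.1 (h (show
    (v.1 + (i : ZMod N) + 1, v.2 + (j : ZMod M)) ∈ _ by simp [cross]))
  obtain ⟨_, _, j₁, hj₁, h₃⟩ := mem_block.1 (h (show
    (v.1 + (i : ZMod N), v.2 + (j : ZMod M) - 1) ∈ _ by simp [cross]))
  obtain ⟨_, _, j₂, hj₂, h₄⟩ := mem_block.1 (h (show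
    (v.1 + (i : ZMod N), v.2 + (j : ZMod M) + 1) ∈ _ by simp [cross]))
  -- The indices compared can be as large as `a` or `b`, so `a < N` and `b < M` are exactly what
  -- rules out wrapping around the torus.
  have e₁ : i = i₁ + 1 := natCast_inj_of_lt (n := N) (by omega) (by omega) (by
    push_cast; linear_combination (Prod.ext_iff.1 h₁).1)
  have e₂ : i + 1 = i₂ := natCast_inj_of_lt (n := N) (by omega) (by omega) (by
    push_cast; linear_combination (Prod.ext_iff.1 h₂).1)
  have e₃ : j = j₁ + 1 := natCast_inj_of_lt (n := M) (by omega) (by omega) (by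
    push_cast; linear_combination (Prod.ext_iff.1 h₃).2)
  have e₄ : j + 1 = j₂ := natCast_inj_of_lt (n := M) (by omega) (by omega) (by
    push_cast; linear_combination (Prod.ext_iff.1 h₄).2)
  exact ⟨i, j, by omega, by omega, by omega, by omega, rfl⟩

theorem cross_subset_block {v w : Site N M} (h₁ : w.1 = v.1 + 1) (h₂ : w.2 = v.2 + 1) :
    cross w ⊆ block v 3 3 := by
  have := cross_subset_square w
  rwa [square, h₁, h₂, add_sub_cancel_right, add_sub_cancel_right] at this

theorem cross_subset_block_right {v w : Site N M} (hN : 4 ≤ N) (hM : 5 ≤ M)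
    (h : cross w ⊆ block v 3 4) :
    cross w ⊆ block v 3 3 ∨ cross w ⊆ block (v.1, v.2 + 1) 3 3 := by
  obtain ⟨i, j, hi, hi', hj, hj', rfl⟩ :=
    exists_of_cross_subset_block (by omega) (by omega) h
  obtain rfl : i = 1 := by omega
  obtain rfl | rfl : j = 1 ∨ j = 2 := by omega
  · exact Or.inl (cross_subset_block (by simp) (by simp))
  · exact Or.inr (cross_subset_block (by simp) (by push_cast; ring))

theorem cross_subset_block_down {v w : Site N M} (hN : 5 ≤ N) (hM : 4 ≤ M)
    (h : cross w ⊆ block v 4 3) :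
    cross w ⊆ block v 3 3 ∨ cross w ⊆ block (v.1 + 1, v.2) 3 3 := by
  obtain ⟨i, j, hi, hi', hj, hj', rfl⟩ :=
    exists_of_cross_subset_block (by omega) (by omega) h
  obtain rfl : j = 1 := by omega
  obtain rfl | rfl : i = 1 ∨ i = 2 := by omega
  · exact Or.inl (cross_subset_block (by simp) (by simp))
  · exact Or.inr (cross_subset_block (by push_cast; ring) (by simp))

theorem eq_of_cross_subset_square {v w : Site N M} (hN : 4 ≤ N) (hM : 4 ≤ M)
    (h : cross w ⊆ square v) : w = v := by
  obtain ⟨i, j, hi, hi', hj, hj', rfl⟩ :=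
    exists_of_cross_subset_block (by omega) (by omega) h
  obtain rfl : i = 1 := by omega
  obtain rfl : j = 1 := by omega
  ext <;> simp

/-- It lets `GSpace` of the large region be treated by the same global-weight criterion as the
ampliated spaces. -/
theorem ampliateSpace_incl_self {d : ℕ} [NeZero d] (S : Finset (Site N M)) (G : Submodule ℂ (Hilb d S)) :
    ampliateSpace (incl (Finset.Subset.refl S)) G = G := by
  have h : ∀ (y : S → Fin d) (χ : Hilb d S),
      slice (incl (Finset.Subset.refl S)) y χ = χ := by
    intro y χ
    ext z
    exact congrArg χ.ofLp (funext fun w => (incl_injective _).extend_apply z y w)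
  ext χ
  simp only [mem_ampliateSpace, h, forall_const]

end Blocks

/-! ### Intersection identities and the projector of the square. -/

section Intersections

variable {N M d : ℕ} [NeZero N] [NeZero M] {φ : BondMatrices N M d}

theorem mem_ampliateSpace_incl_iff [NeZero d] (hφ : ∀ e b, IsUnit (φ e b))
    (hC : ∀ (R : Finset (Site N M)) (x : Site N M → Fin d), contraction φ R x ≠ 0)
    {R S : Finset (Site N M)} (hRS : R ⊆ S) (χ : Hilb d S) :
    χ ∈ ampliateSpace (incl hRS) (GSpace (classicalTensors φ) R) ↔
      ∀ v, cross v ⊆ R → ∀ (x : Site N M → Fin d) (a : Fin d),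
        χ (fun w => Function.update x v a w) /
            contraction φ Finset.univ (Function.update x v a) =
          χ (fun w => x w) / contraction φ Finset.univ x := by
  rw [mem_ampliateSpace]
  exact mem_ampliateSpace_GSpace_iff hφ hC R (f := incl hRS) Subtype.val_injective (fun _ => rfl) χ

theorem ampliateSpace_inf_ampliateSpace [NeZero d] (hφ : ∀ e b, IsUnit (φ e b))
    (hC : ∀ (R : Finset (Site N M)) (x : Site N M → Fin d), contraction φ R x ≠ 0)
    {R₁ R₂ S : Finset (Site N M)} (h₁ : R₁ ⊆ S) (h₂ : R₂ ⊆ S)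
    (h : ∀ v, cross v ⊆ S → cross v ⊆ R₁ ∨ cross v ⊆ R₂) :
    ampliateSpace (incl h₁) (GSpace (classicalTensors φ) R₁) ⊓
        ampliateSpace (incl h₂) (GSpace (classicalTensors φ) R₂) =
      GSpace (classicalTensors φ) S := by
  conv_rhs => rw [← ampliateSpace_incl_self S (GSpace (classicalTensors φ) S)]
  ext χ
  simp only [Submodule.mem_inf, mem_ampliateSpace_incl_iff hφ hC]
  constructor
  · rintro ⟨ha, hb⟩ v hv
    exact (h v hv).elim (ha v) (hb v)
  · exact fun ha => ⟨fun v hv => ha v (hv.trans h₁), fun v hv => ha v (hv.trans h₂)⟩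

theorem ampliateSpace_eq_GSpace [NeZero d] (hφ : ∀ e b, IsUnit (φ e b))
    (hC : ∀ (R : Finset (Site N M)) (x : Site N M → Fin d), contraction φ R x ≠ 0)
    {R S : Finset (Site N M)} (hRS : R ⊆ S) (h : ∀ v, cross v ⊆ S → cross v ⊆ R) :
    ampliateSpace (incl hRS) (GSpace (classicalTensors φ) R) = GSpace (classicalTensors φ) S := by
  rw [← ampliateSpace_inf_ampliateSpace hφ hC hRS hRS fun v hv => Or.inl (h v hv), inf_idem]

theorem parentProj_square [NeZero d] (hφ : ∀ e b, IsUnit (φ e b))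
    (hC : ∀ (R : Finset (Site N M)) (x : Site N M → Fin d), contraction φ R x ≠ 0)
    (hN : 4 ≤ N) (hM : 4 ≤ M) (v : Site N M) :
    parentProj (classicalTensors φ) (square v) =
      ampliate (incl (cross_subset_square v)) (parentProj (classicalTensors φ) (cross v)) := by
  ext1 χ
  exact starProjection_orthogonal_ampliateSpace (incl_injective _)
    (ampliateSpace_eq_GSpace hφ hC (cross_subset_square v) fun w hw => by
      rw [eq_of_cross_subset_square hN hM hw]) χ

end Intersections

/-! ### Failure of injectivity, and the Gibbs form of the state. -/

section Injectivity

variable {N M d : ℕ} [NeZero N] [NeZero M] {φ : BondMatrices N M d}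

theorem val_sub_one_lt {n : ℕ} [NeZero n] {a : ZMod n} (ha : a ≠ 0) : (a - 1).val < a.val := by
  have h := Nat.pos_of_ne_zero fun h0 => ha ((ZMod.val_eq_zero a).1 h0)
  have h1 : (((a.val - 1 : ℕ)) : ZMod n) = a - 1 := by
    rw [Nat.cast_sub h, ZMod.natCast_zmod_val, Nat.cast_one]
  rw [← h1, ZMod.val_natCast, Nat.mod_eq_of_lt (by have := a.val_lt; omega)]
  omega

/-- A nonempty planar region has an upper left corner. -/
theorem exists_corner {R : Finset (Site N M)} (hR : R.Nonempty) (hP : IsPlanar R) :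
    ∃ v ∈ R, (v.1, v.2 - 1) ∉ R ∧ (v.1 - 1, v.2) ∉ R := by
  obtain ⟨⟨r, hr⟩, c, hc⟩ := hP
  -- Coordinates are measured from a missing row `r` and a missing column `c`, so they never vanish
  -- on `R` and one step left or up strictly decreases the sum.
  obtain ⟨v, hv, hmin⟩ := R.exists_min_image (fun v => (v.1 - r).val + (v.2 - c).val) hR
  refine ⟨v, hv, fun h => ?_, fun h => ?_⟩
  · have h1 := hmin _ h
    have h2 : v.2 - c ≠ 0 := fun h0 => hc v.1 (by rwa [← sub_eq_zero.1 h0])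
    have h3 := val_sub_one_lt h2
    rw [sub_right_comm] at h3
    simp only at h1
    omega
  · have h1 := hmin _ h
    have h2 : v.1 - r ≠ 0 := fun h0 => hr v.2 (by rwa [← sub_eq_zero.1 h0])
    have h3 := val_sub_one_lt h2
    rw [sub_right_comm] at h3
    simp only at h1
    omega

/-- The left and upper bonds of the corner both read the site `v`. A tensor whose boundary function
vanishes whenever the two readings agree is therefore killed by `Γ_R`. -/
theorem not_isInjectiveRegion (hd : 2 ≤ d) (hφ : ∀ e b, IsUnit (φ e b))
    {R : Finset (Site N M)} (hR : R.Nonempty) (hP : IsPlanar R) :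
    ¬ IsInjectiveRegion (classicalTensors φ) R := by
  intro hinj
  obtain ⟨v, hv, hl, hu⟩ := exists_corner hR hP
  have hl1 : endpoint (leftBond v) true ∈ R := by rwa [endpoint_leftBond]
  have hu1 : endpoint (upBond v) true ∈ R := by rwa [endpoint_upBond]
  let e₁ : boundaryBonds R := ⟨leftBond v, mem_boundaryBonds_of hl1 hl⟩
  let e₂ : boundaryBonds R := ⟨upBond v, mem_boundaryBonds_of hu1 hu⟩
  have hne : e₁ ≠ e₂ := by simp [e₁, e₂, leftBond, upBond]
  have hs : innerSite R e₁ = innerSite R e₂ := by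
    rw [innerSite_eq hl1 hl, innerSite_eq hu1 hu, endpoint_leftBond, endpoint_upBond]
  obtain ⟨C, hC⟩ := boundaryMap_surjective φ hφ R fun y => if y e₁ = y e₂ then 0 else 1
  have h0 : C = 0 := hinj (by
    rw [map_zero]
    ext z
    have : NeZero d := ⟨by omega⟩
    obtain ⟨x, rfl⟩ : ∃ x : Site N M → Fin d, z = fun w => x w.1 :=
      ⟨Function.extend Subtype.val z fun _ => 0,
        funext fun w => (Subtype.val_injective.extend_apply _ _ _).symm⟩
    rw [Gam_apply, hC]
    simp [hs])
  -- With two levels available the readings 1 and 0 differ, so the boundary function, and with it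
  -- `C`, is nonzero.
  have h1 := congrFun hC (Function.update (fun _ => ⟨0, by omega⟩) e₁ ⟨1, by omega⟩)
  rw [h0] at h1
  simp [boundaryMap, Function.update_of_ne hne.symm] at h1

theorem not_isInjectivePEPS (hd : 2 ≤ d) (hφ : ∀ e b, IsUnit (φ e b)) :
    ¬ IsInjectivePEPS (classicalTensors φ) := by
  rintro ⟨P, hP⟩
  obtain ⟨R, hR, -⟩ := P.exists_mem (Finset.mem_univ ((0, 0) : Site N M))
  exact not_isInjectiveRegion hd hφ (P.nonempty_of_mem_parts hR) (hP R hR).1 (hP R hR).2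

theorem state_eq_exp {h : Bond N M → Fin d → Fin d → ℝ} {β : ℝ} (hf : Factorizes φ h β)
    (x : Site N M → Fin d) :
    state (classicalTensors φ) x = (Real.exp (-(β / 2) * energy h x) : ℂ) := by
  rw [state_eq_contraction, energy, Finset.mul_sum, Real.exp_sum, contraction]
  push_cast
  refine Finset.prod_congr (by simp [interiorBonds]) fun e _ => ?_
  rw [← hf, Complex.ofReal_exp]
  push_cast
  rfl

end Injectivity

end PEPS

theorem mainTheorem3 (N M d : ℕ) [NeZero N] [NeZero M] (hd : 2 ≤ d)
    (φ : BondMatrices N M d)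
    (hφ : ∀ e b, IsUnit (φ e b))
    (hC : ∀ (R : Finset (Site N M)) (x : Site N M → Fin d), contraction φ R x ≠ 0) :
    -- for a classical model, the PEPS is the coherent (unnormalized) Gibbs state
    (∀ (h : Bond N M → Fin d → Fin d → ℝ) (β : ℝ), Factorizes φ h β →
      ∀ x, state (classicalTensors φ) x = (Real.exp (-(β / 2) * energy h x) : ℂ)) ∧
    -- it is not injective
    (∀ R : Finset (Site N M), R.Nonempty → IsPlanar R →
      ¬ IsInjectiveRegion (classicalTensors φ) R) ∧
    ¬ IsInjectivePEPS (classicalTensors φ) ∧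
    -- it is the unique ground state of its frustration-free parent Hamiltonians
    (∀ (R : Site N M → Finset (Site N M)) (h : ∀ v, Hilb d (R v) →ₗ[ℂ] Hilb d (R v)),
      IsParent (classicalTensors φ) R h →
      IsUniqueGroundState (hamiltonian R h) (state (classicalTensors φ)) ∧
      ∀ v, ampliate (Subtype.val : R v → Site N M) (h v) (state (classicalTensors φ)) = 0) ∧
    -- in particular for the projectors on the `3 × 3` squares, and for those on the crosses
    IsUniqueGroundState (hamiltonian square fun v => parentProj (classicalTensors φ) (square v))
      (state (classicalTensors φ)) ∧
    IsUniqueGroundState (hamiltonian cross fun v => parentProj (classicalTensors φ) (cross v))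
      (state (classicalTensors φ)) ∧
    -- intersection identities for two overlapping `3 × 3` blocks
    (4 ≤ N → 5 ≤ M → ∀ v : Site N M,
      ampliateSpace (incl (block_mono v le_rfl (by norm_num : 3 ≤ 4)))
          (GSpace (classicalTensors φ) (block v 3 3)) ⊓
        ampliateSpace (incl (block_right_subset v 3 3))
          (GSpace (classicalTensors φ) (block (v.1, v.2 + 1) 3 3)) =
      GSpace (classicalTensors φ) (block v 3 4)) ∧
    (5 ≤ N → 4 ≤ M → ∀ v : Site N M,
      ampliateSpace (incl (block_mono v (by norm_num : 3 ≤ 4) le_rfl))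
          (GSpace (classicalTensors φ) (block v 3 3)) ⊓
        ampliateSpace (incl (block_down_subset v 3 3))
          (GSpace (classicalTensors φ) (block (v.1 + 1, v.2) 3 3)) =
      GSpace (classicalTensors φ) (block v 4 3)) ∧
    -- the projector of the square is that of the cross, tensored with the identity
    (4 ≤ N → 4 ≤ M → ∀ v : Site N M,
      parentProj (classicalTensors φ) (square v) =
        ampliate (incl (cross_subset_square v))
          (parentProj (classicalTensors φ) (cross v))) := by
  have : NeZero d := ⟨by omega⟩
  refine ⟨fun h β hf x => state_eq_exp hf x, fun R hR hP => not_isInjectiveRegion hd hφ hR hP,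
    not_isInjectivePEPS hd hφ,
    fun R h hP => ⟨hP.isUniqueGroundState hφ hC, hP.ampliate_state hφ hC⟩,
    (isParent_parentProj cross_subset_square).isUniqueGroundState hφ hC,
    (isParent_parentProj fun _ => Finset.Subset.refl _).isUniqueGroundState hφ hC,
    fun hN hM v => ampliateSpace_inf_ampliateSpace hφ hC _ _ fun _ =>
      cross_subset_block_right hN hM,
    fun hN hM v => ampliateSpace_inf_ampliateSpace hφ hC _ _ fun _ =>
      cross_subset_block_down hN hM,
    fun hN hM v => parentProj_square hφ hC hN hM v⟩
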